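/- Let $R$ be a commutative ring with identity and let $C$ be a semidualizing $R$-module, i.e. $C$ admits a projective resolution by finitely generated projective modules, the homothety map $R\to\operatorname{Hom}_R(C,C)$ is an isomorphism, and $\operatorname{Ext}^{n}_R(C,C)=0$ for all $n\ge 1$. For a class $\mathcal X$ of $R$-modules let $\widetilde{\mathcal X}$ be the class of exact ($\mathbb Z$-indexed) complexes of $R$-modules all of whose cycle modules lie in $\mathcal X$. Let $\mathcal P$ be the class of projective $R$-modules, $\mathcal P_C$ the class of modules isomorphic to $C\otimes_R P$ with $P$ projective, and $\mathcal F_C$ the class of modules isomorphic to $C\otimes_R F$ with $F$ flat. A complex $X$ of $R$-modules is called $D_C$-projective if there is an exact sequence of complexes of $R$-modules $$\cdots\to P_1\xrightarrow{f_1}P_0\xrightarrow{f_0}Q_{-1}\xrightarrow{f_{-1}}Q_{-2}\to\cdots$$ with all $P_i\in\widetilde{\mathcal P}$ and all $Q_i\in\widetilde{\mathcal P_C}$, which remains exact after applying $\operatorname{Hom}(-,H)$ (the group of morphisms of complexes) for every $H\in\widetilde{\mathcal F_C}$, and such that $X\cong\operatorname{Im} f_0$. Then the class of $D_C$-projective complexes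 is closed under direct summands and direct sums: 1. if $X$ is $D_C$-projective and $X\cong A\oplus B$ for complexes $A,B$ of $R$-modules, then $A$ is $D_C$-projective; 2. if $(X_\lambda)_{\lambda\in\Lambda}$ is any family, indexed by a set $\Lambda$, of $D_C$-projective complexes, then $\bigoplus_{\lambda\in\Lambda}X_\lambda$ is $D_C$-projective. -/

import Mathlib

open CategoryTheory Limits
open scoped TensorProduct

universe u

namespace DingComplex

variable {R : Type u} [CommRing R]

/-- The category `Ch(R)` of (unbounded, homologically graded) complexes of `R`-modules
`⋯ ⟶ Xⁿ⁺¹ ⟶ Xⁿ ⟶ Xⁿ⁻¹ ⟶ ⋯`. -/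
abbrev Ch (R : Type u) [CommRing R] := ChainComplex (ModuleCat.{u} R) ℤ

/-- Semidualizing modules over a commutative ring. -/
structure IsSemidualizing (C : ModuleCat.{u} R) : Prop where
  /-- `C` admits a degreewise finite projective resolution. -/
  exists_resolution : ∃ P : ProjectiveResolution C, ∀ n, Module.Finite R (P.complex.X n)
  /-- The homothety map `R → Hom_R(C, C)`, `r ↦ (c ↦ r • c)`, is an isomorphism. -/
  homothety_bijective : Function.Bijective (LinearMap.lsmul R C)
  /-- `Ext_R^n(C, C) = 0` for `n ≥ 1`. -/
  ext_eq_zero : ∀ n : ℕ, 1 ≤ n → Subsingleton (Abelian.Ext C C n)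

/-- The class of projective modules. -/
def projectiveModules (R : Type u) [CommRing R] : ObjectProperty (ModuleCat.{u} R) :=
  fun M => Module.Projective R M

/-- The class of `C`-projective modules: those of the form `C ⊗ P` with `P` projective. -/
def cProjectiveModules (C : ModuleCat.{u} R) : ObjectProperty (ModuleCat.{u} R) :=
  fun M => ∃ P : ModuleCat.{u} R, Module.Projective R P ∧ Nonempty (M ≃ₗ[R] C ⊗[R] P)

/-- The class of `C`-flat modules: those of the form `C ⊗ F` with `F` flat. -/
def cFlatModules (C : ModuleCat.{u} R) : ObjectProperty (ModuleCat.{u} R) :=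
  fun M => ∃ F : ModuleCat.{u} R, Module.Flat R F ∧ Nonempty (M ≃ₗ[R] C ⊗[R] F)

/-- For a class `𝒳` of modules, the class of `𝒳`-complexes: the exact complexes all of whose
cycle modules belong to `𝒳`. -/
def tilde (𝒳 : ObjectProperty (ModuleCat.{u} R)) : ObjectProperty (Ch R) :=
  fun X => X.Acyclic ∧ ∀ i : ℤ, 𝒳 (X.cycles i)

/-- A sequence `E` in a preadditive category is `Hom(-, 𝓑)`-exact if for every `B` in `𝓑` the
sequence of abelian groups `⋯ ⟶ Hom(Eᵢ₋₁, B) ⟶ Hom(Eᵢ, B) ⟶ Hom(Eᵢ₊₁, B) ⟶ ⋯` is exact. -/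
def IsHomExact {A : Type*} [Category* A] [Preadditive A] (𝓑 : ObjectProperty A)
    (E : ChainComplex A ℤ) : Prop :=
  ∀ B : A, 𝓑 B → ∀ i : ℤ, Function.Exact
    (fun g : E.X (i - 1) ⟶ B => E.d i (i - 1) ≫ g)
    (fun g : E.X i ⟶ B => E.d (i + 1) i ≫ g)

/-- `D_C`-projective complexes. In the exact sequence of complexes `E`, the terms of index `i ≥ 0`
are the `Pᵢ`, those of index `i < 0` are the `Qᵢ`, and `E.d 0 (-1)` is `f₀ : P₀ ⟶ Q₋₁`. -/
def IsDCProjective (C : ModuleCat.{u} R) : ObjectProperty (Ch R) :=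
  fun X => ∃ E : ChainComplex (Ch R) ℤ,
    E.Acyclic ∧
    IsHomExact (tilde (cFlatModules C)) E ∧
    (∀ i : ℤ, 0 ≤ i → tilde (projectiveModules R) (E.X i)) ∧
    (∀ i : ℤ, i < 0 → tilde (cProjectiveModules C) (E.X i)) ∧
    Nonempty (X ≅ image (E.d 0 (-1)))

end DingComplex

/-! Call a short exact sequence admissible if it stays exact under `Hom(-, H)` for every `H` in
`tilde (cFlatModules C)`. Cutting the defining sequence of a `D_C`-projective complex at `f₀` shows
that `X` is `D_C`-projective if and only if it has an admissible resolution by `𝒫`-complexes and an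
admissible coresolution by `𝒫_C`-complexes, and the two halves can be treated independently. A
`𝒫`-complex is a projective object of `Ch(R)`, and a `𝒫_C`-complex is injective relative to the
admissible sequences because it is an `ℱ_C`-complex; this makes the horseshoe lemma available on
both sides. If `P ⟶ X ⊞ Y` is the first step of a resolution, then `ker (P ⟶ X) ⊞ X` is an extension
of `X ⊞ Y` by `ker (P ⟶ X ⊞ Y)`, hence again resolved, so the argument can be repeated with
`ker (P ⟶ X)` in place of `X`. For direct sums, coproducts of complexes are exact. -/

namespace DingComplex

section Colimits

variable {A : Type*} [Category* A] [Abelian A]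

lemma exact_of_evaluation {J : Type*} [Category* J] {S : ShortComplex (J ⥤ A)}
    (h : ∀ j, (S.map ((evaluation J A).obj j)).Exact) : S.Exact := by
  rw [ShortComplex.exact_iff_isZero_homology, Functor.isZero_iff]
  exact fun j => .of_iso ((ShortComplex.exact_iff_isZero_homology _).1 (h j))
    (S.mapHomologyIso ((evaluation J A).obj j)).symm

lemma shortExact_of_evaluation {J : Type*} [Category* J] {S : ShortComplex (J ⥤ A)}
    (h : ∀ j, (S.map ((evaluation J A).obj j)).ShortExact) : S.ShortExact :=
  have (j : J) : Mono (S.f.app j) := (h j).mono_f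
  have (j : J) : Epi (S.g.app j) := (h j).epi_g
  .mk' (exact_of_evaluation fun j => (h j).exact) (NatTrans.mono_of_mono_app S.f)
    (NatTrans.epi_of_epi_app S.g)

variable {J : Type*} [HasColimitsOfShape (Discrete J) A] {X Y : J → A}

/-- Exact coproducts commute with kernels. -/
noncomputable def kernelSigmaMapIso [HasExactColimitsOfShape (Discrete J) A]
    (f : ∀ j, X j ⟶ Y j) : kernel (Limits.Sigma.map f) ≅ ∐ fun j => kernel (f j) :=
  let F : Discrete.functor X ⟶ Discrete.functor Y := Discrete.natTrans fun j => f j.as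
  (PreservesKernel.iso colim F).symm ≪≫ HasColimit.isoOfNatIso
    (Discrete.natIso fun j => PreservesKernel.iso ((evaluation _ _).obj j) F)

/-- Coproducts commute with cokernels. -/
noncomputable def cokernelSigmaMapIso (f : ∀ j, X j ⟶ Y j) :
    cokernel (Limits.Sigma.map f) ≅ ∐ fun j => cokernel (f j) :=
  let F : Discrete.functor X ⟶ Discrete.functor Y := Discrete.natTrans fun j => f j.as
  (PreservesCokernel.iso colim F).symm ≪≫ HasColimit.isoOfNatIso
    (Discrete.natIso fun j => PreservesCokernel.iso ((evaluation _ _).obj j) F)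

lemma shortExact_sigmaMap [HasExactColimitsOfShape (Discrete J) A] {S : J → ShortComplex A}
    (h : ∀ j, (S j).ShortExact) :
    (ShortComplex.mk (Limits.Sigma.map fun j => (S j).f) (Limits.Sigma.map fun j => (S j).g)
      (by ext; simp)).ShortExact :=
  let f : Discrete.functor (fun j => (S j).X₁) ⟶ Discrete.functor fun j => (S j).X₂ :=
    Discrete.natTrans fun j => (S j.as).f
  let g : Discrete.functor (fun j => (S j).X₂) ⟶ Discrete.functor fun j => (S j).X₃ :=
    Discrete.natTrans fun j => (S j.as).g
  (shortExact_of_evaluation (S := .mk f g (by ext j; exact (S j.as).zero)) fun j =>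
    h j.as).map_of_exact colim

lemma shortExact_of_isColimit {K : Type*} [Category* K] [HasColimitsOfShape K A]
    [HasExactColimitsOfShape K A] {S : ShortComplex (K ⥤ A)} (hS : S.ShortExact)
    {c₁ : Cocone S.X₁} (hc₁ : IsColimit c₁) {c₂ : Cocone S.X₂} (hc₂ : IsColimit c₂)
    {c₃ : Cocone S.X₃} (hc₃ : IsColimit c₃) (f : c₁.pt ⟶ c₂.pt) (g : c₂.pt ⟶ c₃.pt)
    (hf : ∀ j, c₁.ι.app j ≫ f = S.f.app j ≫ c₂.ι.app j)
    (hg : ∀ j, c₂.ι.app j ≫ g = S.g.app j ≫ c₃.ι.app j) :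
    (colim.mapShortComplex S hc₁ c₂ c₃ f g hf hg).ShortExact :=
  have := hS.mono_f
  have := hS.epi_g
  .mk' (colim.exact_mapShortComplex hS.exact hc₁ hc₂ hc₃ f g hf hg)
    (colim.map_mono' S.f hc₁ hc₂ f hf) (colim.map_epi' S.g c₂ hc₃ g hg)

end Colimits

section Resolutions

variable {A : Type*} [Category* A] [Abelian A]

section Kernels

variable {X Y Z : A}

lemma shortExact_kernel (p : X ⟶ Y) [Epi p] :
    (ShortComplex.mk _ _ (kernel.condition p)).ShortExact :=
  .mk' (ShortComplex.exact_kernel p) (inferInstanceAs (Mono (kernel.ι p))) ‹_›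

lemma shortExact_cokernel (i : X ⟶ Y) [Mono i] :
    (ShortComplex.mk _ _ (cokernel.condition i)).ShortExact :=
  .mk' (ShortComplex.exact_cokernel i) ‹_› (inferInstanceAs (Epi (cokernel.π i)))

lemma isPullback_biprod_snd_desc {P : A} (g : Y ⟶ Z) (e : P ⟶ Y) :
    IsPullback biprod.snd (biprod.desc (kernel.ι g) e) (e ≫ g) g :=
  .of_isLimit' ⟨by ext <;> simp⟩ <| PullbackCone.IsLimit.mk _
    (fun s => biprod.lift (kernel.lift g (s.snd - s.fst ≫ e) (by simp [s.condition])) s.fst)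
    (fun s => by simp) (fun s => by simp [biprod.lift_desc])
    fun s m hfst hsnd => by
      ext
      · simp [← hfst, ← hsnd, biprod.desc_eq]
      · simpa using hfst

lemma isPullback_biprod_map_id (f : X ⟶ Y) (Z : A) :
    IsPullback (biprod.map f (𝟙 Z)) biprod.fst biprod.fst f :=
  .of_isLimit' ⟨by simp⟩ <| PullbackCone.IsLimit.mk _
    (fun s => biprod.lift s.snd (s.fst ≫ biprod.snd))
    (fun s => by ext <;> simp [s.condition]) (fun s => by simp)
    fun s m hfst hsnd => by ext <;> simp [← hfst, ← hsnd]

lemma isPullback_kernel_map_comp (f : X ⟶ Y) (g : Y ⟶ Z) :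
    IsPullback (kernel.ι (f ≫ g)) (kernel.map (f ≫ g) g f (𝟙 Z) (by simp)) f (kernel.ι g) :=
  .of_isLimit' ⟨by simp⟩ <| PullbackCone.IsLimit.mk _
    (fun s => kernel.lift (f ≫ g) s.fst (by rw [s.condition_assoc, kernel.condition, comp_zero]))
    (fun s => by simp) (fun s => by simp [← cancel_mono (kernel.ι g), s.condition])
    fun s m hfst _ => by ext; simpa using hfst

/-- The left morphism of a pullback square has the same kernel as the right one. -/
noncomputable def kernelIsoOfIsPullback {P : A} {t : P ⟶ X} {l : P ⟶ Y} {r : X ⟶ Z} {b : Y ⟶ Z}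
    (sq : IsPullback t l r b) : kernel l ≅ kernel r :=
  have := isIso_kernel_map_of_isPullback sq.flip
  asIso (kernel.map _ _ _ _ sq.flip.w)

lemma kernelIsoOfIsPullback_hom_ι {P : A} {t : P ⟶ X} {l : P ⟶ Y} {r : X ⟶ Z} {b : Y ⟶ Z}
    (sq : IsPullback t l r b) :
    (kernelIsoOfIsPullback sq).hom ≫ kernel.ι r = kernel.ι l ≫ t :=
  kernel.lift_ι _ _ _

end Kernels

variable {W : MorphismProperty A} {𝓟 𝓠 : ObjectProperty A}

/-- The objects that are projective relative to the class `W` of morphisms: every morphism from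
such an object to the target of a morphism of `W` lifts to the source. -/
def relProjective (W : MorphismProperty A) : ObjectProperty A :=
  fun P => ∀ ⦃Y Z : A⦄ (g : Y ⟶ Z), W g → ∀ f : P ⟶ Z, ∃ l : P ⟶ Y, l ≫ g = f

/-- The objects with a resolution `⋯ ⟶ P₁ ⟶ P₀ ⟶ X` by objects of `𝓟` in which `P₀ ⟶ X` and all
the maps `Pₙ₊₁ ⟶ ker (Pₙ ⟶ Pₙ₋₁)` belong to `W`. It is encoded coinductively, as the largest class
every object `Y` of which has a morphism `P ⟶ Y` in `W` from an object of `𝓟`, with kernel in the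
class. -/
def IsResolved (W : MorphismProperty A) (𝓟 : ObjectProperty A) : ObjectProperty A :=
  fun X => ∃ 𝓖 : ObjectProperty A, 𝓖 X ∧
    ∀ Y, 𝓖 Y → ∃ (P : A) (p : P ⟶ Y), 𝓟 P ∧ W p ∧ 𝓖 (kernel p)

namespace IsResolved

lemma exists_kernel {X : A} (h : IsResolved W 𝓟 X) :
    ∃ (P : A) (p : P ⟶ X), 𝓟 P ∧ W p ∧ IsResolved W 𝓟 (kernel p) := by
  obtain ⟨𝓖, hX, h𝓖⟩ := h
  obtain ⟨P, p, hP, hp, hK⟩ := h𝓖 X hX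
  exact ⟨P, p, hP, hp, 𝓖, hK, h𝓖⟩

lemma of_coinduction [W.RespectsIso] {𝓖 : ObjectProperty A}
    (h𝓖 : ∀ Y, 𝓖 Y → ∃ (P : A) (p : P ⟶ Y), 𝓟 P ∧ W p ∧ 𝓖.isoClosure (kernel p)) :
    𝓖.isoClosure ≤ IsResolved W 𝓟 := by
  refine fun X hX => ⟨𝓖.isoClosure, hX, ?_⟩
  rintro Y ⟨Y', hY', ⟨e⟩⟩
  obtain ⟨P, p, hP, hp, hK⟩ := h𝓖 Y' hY'
  exact ⟨P, p ≫ e.inv, hP, (W.cancel_right_of_respectsIso _ _).2 hp,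
    𝓖.isoClosure.prop_of_iso (kernelCompMono p e.inv).symm hK⟩

instance [W.RespectsIso] : (IsResolved W 𝓟).IsClosedUnderIsomorphisms where
  of_iso e hX := of_coinduction (fun _ hY => by
    obtain ⟨P, p, hP, hp, hK⟩ := hY.exists_kernel
    exact ⟨P, p, hP, hp, ObjectProperty.le_isoClosure _ _ hK⟩) _ ⟨_, hX, ⟨e.symm⟩⟩

/-- The horseshoe lemma. -/
lemma of_kernel [W.IsMultiplicative] [W.IsStableUnderBaseChange] (h𝓟 : 𝓟 ≤ relProjective W)
    (h𝓟' : ∀ P₁ P₂, 𝓟 P₁ → 𝓟 P₂ → 𝓟 (P₁ ⊞ P₂)) {Y Z : A} (g : Y ⟶ Z) (hg : W g)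
    (hK : IsResolved W 𝓟 (kernel g)) (hZ : IsResolved W 𝓟 Z) : IsResolved W 𝓟 Y := by
  let 𝓖 : ObjectProperty A := fun Y => ∃ (Z : A) (g : Y ⟶ Z), W g ∧
    IsResolved W 𝓟 (kernel g) ∧ IsResolved W 𝓟 Z
  refine of_coinduction (𝓖 := 𝓖) ?_ Y (𝓖.le_isoClosure _ ⟨Z, g, hg, hK, hZ⟩)
  rintro Y ⟨Z, g, hg, hK, hZ⟩
  obtain ⟨P₁, p₁, hP₁, hp₁, hK₁⟩ := hK.exists_kernel
  obtain ⟨P₂, p₂, hP₂, hp₂, hK₂⟩ := hZ.exists_kernel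
  obtain ⟨e, rfl⟩ := h𝓟 _ hP₂ g hg p₂
  have sq₁ := isPullback_biprod_map_id p₁ P₂
  have sq₂ := isPullback_biprod_snd_desc g e
  have sq₃ := isPullback_kernel_map_comp (biprod.map p₁ (𝟙 P₂)) (biprod.desc (kernel.ι g) e)
  have h₁ : W (biprod.map p₁ (𝟙 P₂)) := W.of_isPullback sq₁.flip hp₁
  have h₂ : W (biprod.desc (kernel.ι g) e) := W.of_isPullback sq₂ hp₂
  refine ⟨P₁ ⊞ P₂, _, h𝓟' _ _ hP₁ hP₂, W.comp_mem _ _ h₁ h₂, 𝓖.le_isoClosure _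
    ⟨_, _, W.of_isPullback sq₃ h₁, ?_, ?_⟩⟩
  · exact ObjectProperty.prop_of_iso _
      (kernelIsoOfIsPullback sq₃ ≪≫ kernelIsoOfIsPullback sq₁.flip).symm hK₁
  · exact ObjectProperty.prop_of_iso _ (kernelIsoOfIsPullback sq₂).symm hK₂

lemma of_biprod [W.IsMultiplicative] [W.IsStableUnderBaseChange]
    (hW : ∀ X Y : A, W (biprod.fst : X ⊞ Y ⟶ X)) (h𝓟 : 𝓟 ≤ relProjective W)
    (h𝓟' : ∀ P₁ P₂, 𝓟 P₁ → 𝓟 P₂ → 𝓟 (P₁ ⊞ P₂)) {X Y : A} (h : IsResolved W 𝓟 (X ⊞ Y)) :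
    IsResolved W 𝓟 X := by
  let 𝓖 : ObjectProperty A := fun X => ∃ Y, IsResolved W 𝓟 (X ⊞ Y)
  refine of_coinduction (𝓖 := 𝓖) ?_ X (𝓖.le_isoClosure _ ⟨Y, h⟩)
  rintro X ⟨Y, h⟩
  obtain ⟨P, p, hP, hp, hK⟩ := h.exists_kernel
  have sq := isPullback_kernel_map_comp p biprod.fst
  let k := kernel.map (p ≫ biprod.fst) biprod.fst p (𝟙 X) (by simp)
  have sq' := isPullback_biprod_map_id k X
  have hk : W (biprod.map k (𝟙 X)) := W.of_isPullback sq'.flip (W.of_isPullback sq hp)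
  -- `ker (P ⟶ X) ⊞ X` is an extension of `ker (X ⊞ Y ⟶ X) ⊞ X ≅ X ⊞ Y` by `ker p`.
  refine ⟨P, p ≫ biprod.fst, hP, W.comp_mem _ _ hp (hW _ _), 𝓖.le_isoClosure _
    ⟨X, of_kernel h𝓟 h𝓟' _ hk ?_ ?_⟩⟩
  · exact ObjectProperty.prop_of_iso _
      (kernelIsoOfIsPullback sq'.flip ≪≫ kernelIsoOfIsPullback sq).symm hK
  · exact ObjectProperty.prop_of_iso _
      (biprod.braiding _ _ ≪≫ biprod.mapIso (Iso.refl X) kernelBiprodFstIso).symm h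

lemma sigma {J : Type*} [HasColimitsOfShape (Discrete J) A]
    [HasExactColimitsOfShape (Discrete J) A] [W.RespectsIso]
    [W.IsStableUnderCoproductsOfShape J] [𝓟.IsClosedUnderColimitsOfShape (Discrete J)]
    {X : J → A} (h : ∀ j, IsResolved W 𝓟 (X j)) : IsResolved W 𝓟 (∐ X) := by
  let 𝓖 : ObjectProperty A := fun Y => ∃ X : J → A, (∀ j, IsResolved W 𝓟 (X j)) ∧ Y = ∐ X
  refine of_coinduction (𝓖 := 𝓖) ?_ _ (𝓖.le_isoClosure _ ⟨X, h, rfl⟩)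
  rintro _ ⟨X, h, rfl⟩
  choose P p hP hp hK using fun j => (h j).exists_kernel
  exact ⟨∐ P, Limits.Sigma.map p, 𝓟.prop_colimit _ fun j => hP j.as,
    W.colimMap _ fun j => hp j.as,
    _, ⟨_, hK, rfl⟩, ⟨kernelSigmaMapIso p⟩⟩

end IsResolved

/-- The dual of `IsResolved`: the objects with a coresolution by objects of `𝓠` all of whose
corestrictions to the cokernels belong to `W`. -/
def IsCoresolved (W : MorphismProperty A) (𝓠 : ObjectProperty A) : ObjectProperty A :=
  (IsResolved W.op 𝓠.op).unop

namespace IsCoresolved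

instance [W.RespectsIso] : (IsCoresolved W 𝓠).IsClosedUnderIsomorphisms :=
  inferInstanceAs (IsResolved W.op 𝓠.op).unop.IsClosedUnderIsomorphisms

lemma exists_cokernel [W.RespectsIso] {X : A} (h : IsCoresolved W 𝓠 X) :
    ∃ (Q : A) (i : X ⟶ Q), 𝓠 Q ∧ W i ∧ IsCoresolved W 𝓠 (cokernel i) := by
  obtain ⟨Q, i, hQ, hi, hK⟩ := IsResolved.exists_kernel h
  exact ⟨Q.unop, i.unop, hQ, hi, (IsCoresolved W 𝓠).prop_of_iso (cokernelUnopUnop i).symm hK⟩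

lemma of_coinduction [W.RespectsIso] {𝓖 : ObjectProperty A}
    (h𝓖 : ∀ Y, 𝓖 Y → ∃ (Q : A) (i : Y ⟶ Q), 𝓠 Q ∧ W i ∧ 𝓖.isoClosure (cokernel i)) :
    𝓖.isoClosure ≤ IsCoresolved W 𝓠 := by
  rintro X ⟨Y, hY, ⟨e⟩⟩
  refine IsResolved.of_coinduction (𝓖 := 𝓖.op) ?_ _ ⟨.op Y, hY, ⟨e.op.symm⟩⟩
  intro Y hY
  obtain ⟨Q, i, hQ, hi, Z, hZ, ⟨e⟩⟩ := h𝓖 Y.unop hY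
  exact ⟨.op Q, i.op, hQ, hi, .op Z, hZ, ⟨kernelOpOp i ≪≫ e.op.symm⟩⟩

lemma of_biprod [W.IsMultiplicative] [W.IsStableUnderCobaseChange]
    (hW : ∀ X Y : A, W (biprod.inl : X ⟶ X ⊞ Y)) (h𝓠 : 𝓠.op ≤ relProjective W.op)
    [𝓠.IsClosedUnderIsomorphisms] (h𝓠' : ∀ Q₁ Q₂, 𝓠 Q₁ → 𝓠 Q₂ → 𝓠 (Q₁ ⊞ Q₂))
    {X Y : A} (h : IsCoresolved W 𝓠 (X ⊞ Y)) : IsCoresolved W 𝓠 X :=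
  IsResolved.of_biprod (W := W.op) (𝓟 := 𝓠.op) (fun X Y => by
      rw [← biprod.opIso_inv_inl_op X.unop Y.unop, W.op.cancel_left_of_respectsIso]
      exact hW _ _) h𝓠
    (fun _ _ h₁ h₂ => 𝓠.op.prop_of_iso (biprod.opIso _ _) (h𝓠' _ _ h₁ h₂))
    (ObjectProperty.prop_of_iso _ (biprod.opIso X Y) h)

lemma sigma {J : Type*} [HasColimitsOfShape (Discrete J) A] [W.RespectsIso]
    [W.IsStableUnderCoproductsOfShape J] [𝓠.IsClosedUnderColimitsOfShape (Discrete J)]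
    {X : J → A} (h : ∀ j, IsCoresolved W 𝓠 (X j)) : IsCoresolved W 𝓠 (∐ X) := by
  let 𝓖 : ObjectProperty A := fun Y => ∃ X : J → A, (∀ j, IsCoresolved W 𝓠 (X j)) ∧ Y = ∐ X
  refine of_coinduction (𝓖 := 𝓖) ?_ _ (𝓖.le_isoClosure _ ⟨X, h, rfl⟩)
  rintro _ ⟨X, h, rfl⟩
  choose Q i hQ hi hK using fun j => (h j).exists_cokernel
  exact ⟨∐ Q, Limits.Sigma.map i, 𝓠.prop_colimit _ fun j => hQ j.as,
    W.colimMap _ fun j => hi j.as, _, ⟨_, hK, rfl⟩, ⟨cokernelSigmaMapIso i⟩⟩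

end IsCoresolved

variable (𝓗 : ObjectProperty A)

/-- The admissible monomorphisms of the exact structure formed by the short exact sequences that
stay exact under `Hom(-, H)` for all `H` in `𝓗`. -/
def homExactMono : MorphismProperty A :=
  fun X Y i => Mono i ∧ ∀ H, 𝓗 H → ∀ h : X ⟶ H, ∃ k : Y ⟶ H, i ≫ k = h

/-- The admissible epimorphisms of the exact structure formed by the short exact sequences that
stay exact under `Hom(-, H)` for all `H` in `𝓗`. -/
def homExactEpi : MorphismProperty A :=
  fun _ _ p => Epi p ∧ homExactMono 𝓗 (kernel.ι p)

variable {𝓗}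

instance : (homExactMono 𝓗).IsMultiplicative where
  id_mem _ := ⟨inferInstance, fun _ _ h => ⟨h, by simp⟩⟩
  comp_mem i j := fun ⟨_, hi⟩ ⟨_, hj⟩ => ⟨mono_comp i j, fun H hH h => by
    obtain ⟨k, rfl⟩ := hi H hH h
    obtain ⟨l, rfl⟩ := hj H hH k
    exact ⟨l, Category.assoc _ _ _⟩⟩

instance : (homExactMono 𝓗).IsStableUnderCobaseChange where
  of_isPushout sq := fun ⟨_, hi⟩ =>
    ⟨(MorphismProperty.monomorphisms A).of_isPushout sq ‹Mono _›, fun H hH h => by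
      obtain ⟨k, hk⟩ := hi H hH (_ ≫ h)
      exact ⟨_, sq.inl_desc h k hk.symm⟩⟩

instance {J : Type*} [HasColimitsOfShape (Discrete J) A]
    [HasExactColimitsOfShape (Discrete J) A] :
    (homExactMono 𝓗).IsStableUnderCoproductsOfShape J :=
  .mk _ J fun X Y _ _ i hi => by
    have := fun j => (hi j).1
    refine ⟨inferInstance, fun H hH h => ?_⟩
    choose k hk using fun j => (hi j).2 H hH (Sigma.ι X j ≫ h)
    exact ⟨Sigma.desc k, by ext; simp [hk]⟩

lemma homExactMono_biprod_inl (X Y : A) : homExactMono 𝓗 (biprod.inl : X ⟶ X ⊞ Y) :=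
  ⟨inferInstance, fun _ _ h => ⟨biprod.fst ≫ h, by simp⟩⟩

omit [Abelian A] in
lemma op_le_relProjective : 𝓗.op ≤ relProjective (homExactMono 𝓗).op :=
  fun H hH _ _ i hi h => by
    obtain ⟨k, hk⟩ := hi.2 _ hH h.unop
    exact ⟨k.op, Quiver.Hom.unop_inj hk⟩

lemma projective_le_relProjective : isProjective A ≤ relProjective (homExactEpi 𝓗) :=
  fun _ hP _ _ p hp f =>
    have := hp.1
    ⟨Projective.factorThru f p, by simp⟩

lemma homExactEpi_g_iff {S : ShortComplex A} (hS : S.ShortExact) :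
    homExactEpi 𝓗 S.g ↔ homExactMono 𝓗 S.f := by
  have := hS.mono_f
  have := hS.epi_g
  have e : S.f = (hS.fIsKernel.conePointUniqueUpToIso (kernelIsKernel S.g)).hom ≫ kernel.ι S.g :=
    (IsLimit.conePointUniqueUpToIso_hom_comp hS.fIsKernel (kernelIsKernel S.g)
      WalkingParallelPair.zero).symm
  rw [e, (homExactMono 𝓗).cancel_left_of_respectsIso]
  exact ⟨And.right, And.intro hS.epi_g⟩

lemma homExactEpi_biprod_fst (X Y : A) : homExactEpi 𝓗 (biprod.fst : X ⊞ Y ⟶ X) :=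
  (homExactEpi_g_iff
    (S := .mk (biprod.inr : Y ⟶ X ⊞ Y) biprod.fst biprod.inr_fst)
    (ShortComplex.Splitting.shortExact ⟨biprod.snd, biprod.inl, by simp, by simp, by
      simp [add_comm]⟩)).2
    ⟨inferInstance, fun _ _ h => ⟨biprod.snd ≫ h, by simp⟩⟩

instance : (homExactEpi 𝓗).IsStableUnderBaseChange where
  of_isPullback {_ _ _ _ _ _ f' g'} sq := fun ⟨_, _, hp⟩ =>
    ⟨Abelian.epi_snd_of_isLimit _ _ sq.isLimit, inferInstance, fun H hH h => by
      obtain ⟨k, hk⟩ := hp H hH ((kernelIsoOfIsPullback sq).inv ≫ h)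
      exact ⟨f' ≫ k, by
        rw [← reassoc_of% kernelIsoOfIsPullback_hom_ι sq, hk, Iso.hom_inv_id_assoc]⟩⟩

instance : (homExactEpi 𝓗).IsMultiplicative where
  id_mem _ := ⟨inferInstance, inferInstance, fun _ _ h =>
    ⟨0, (zero_of_source_iso_zero h (kernel.ofMono _)).symm ▸ comp_zero⟩⟩
  comp_mem {X Y Z} f g := fun hf hg => ⟨epi_comp' hf.1 hg.1, inferInstance, fun H hH h => by
    have sq := isPullback_kernel_map_comp f g
    let u := kernel.map (f ≫ g) g f (𝟙 Z) (by simp)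
    have : Epi u := ((homExactEpi 𝓗).of_isPullback sq hf).1
    obtain ⟨k, hk⟩ := hf.2.2 H hH ((kernelIsoOfIsPullback sq).inv ≫ kernel.ι u ≫ h)
    have hu : kernel.ι u ≫ (h - kernel.ι (f ≫ g) ≫ k) = 0 := by
      rw [Preadditive.comp_sub, ← reassoc_of% kernelIsoOfIsPullback_hom_ι sq, hk,
        Iso.hom_inv_id_assoc, sub_self]
    obtain ⟨l, hl⟩ := hg.2.2 H hH (Abelian.epiDesc u _ hu)
    refine ⟨k + f ≫ l, ?_⟩
    have hul : kernel.ι (f ≫ g) ≫ f ≫ l = h - kernel.ι (f ≫ g) ≫ k := by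
      rw [← Abelian.comp_epiDesc u _ hu, ← hl, kernel.lift_ι_assoc, Category.assoc]
    rw [Preadditive.comp_add, hul, add_sub_cancel]⟩

instance {J : Type*} [HasColimitsOfShape (Discrete J) A]
    [HasExactColimitsOfShape (Discrete J) A] :
    (homExactEpi 𝓗).IsStableUnderCoproductsOfShape J :=
  .mk _ J fun X Y _ _ p hp => by
    have := fun j => (hp j).1
    exact (homExactEpi_g_iff (shortExact_sigmaMap fun j => shortExact_kernel (p j))).2
      ((homExactMono 𝓗).colimMap _ fun j => (hp j.as).2)

end Resolutions

section Splicing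

variable {A : Type*} [Category* A] [Abelian A]

/-- A presentation of a complex `E` as a splicing of short exact sequences
`0 ⟶ Z (i + 1) ⟶ E.X (i + 1) ⟶ Z i ⟶ 0`. -/
structure Splicing (E : ChainComplex A ℤ) where
  /-- The outer terms of the short exact sequences. -/
  Z : ℤ → A
  /-- The inclusion of `Z i`. -/
  ι : ∀ i, Z i ⟶ E.X i
  /-- The projection onto `Z i`. -/
  π : ∀ i, E.X (i + 1) ⟶ Z i
  π_ι : ∀ i, π i ≫ ι i = E.d (i + 1) i
  ι_π : ∀ i, ι (i + 1) ≫ π i = 0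
  shortExact : ∀ i, (ShortComplex.mk _ _ (ι_π i)).ShortExact

lemma epi_toCycles {E : ChainComplex A ℤ} (hE : E.Acyclic) (i : ℤ) :
    Epi (E.toCycles (i + 1) i) := by
  have hex := hE i
  rw [HomologicalComplex.exactAt_iff' E (i + 1) i (i - 1) (by simp) (by simp)] at hex
  have h := E.toCycles_cyclesIsoSc'_hom (i + 1) i (i - 1) (by simp) (by simp)
  have := hex.epi_toCycles
  rw [← h] at this
  exact (epi_comp_iff_of_isIso _ _).1 this

omit [Abelian A] in
lemma toCycles_cyclesMap [Preadditive A] [CategoryWithHomology A] {E E' : ChainComplex A ℤ}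
    (f : E ⟶ E') (i j : ℤ) :
    E.toCycles i j ≫ HomologicalComplex.cyclesMap f j = f.f i ≫ E'.toCycles i j := by
  simp [← cancel_mono (E'.iCycles j)]

lemma projective_of_homotopy {κ : Type*} {c : ComplexShape κ} {E : HomologicalComplex A c}
    [∀ i, Projective (E.X i)] (h : Homotopy (𝟙 E) 0) : Projective E where
  factors {M N} f e _ := by
    refine ⟨Homotopy.nullHomotopicMap fun i j =>
      h.hom i j ≫ Projective.factorThru (f.f j) (e.f j), ?_⟩
    have hE : 𝟙 E = Homotopy.nullHomotopicMap h.hom := by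
      ext i
      simpa [Homotopy.nullHomotopicMap] using h.comm i
    simp only [Homotopy.nullHomotopicMap_comp, Category.assoc, Projective.factorThru_comp]
    rw [← Homotopy.nullHomotopicMap_comp, ← hE, Category.id_comp]

namespace Splicing

/-- The splicing of an acyclic complex from its cycles. -/
noncomputable def ofAcyclic {E : ChainComplex A ℤ} (hE : E.Acyclic) : Splicing E where
  Z i := E.cycles i
  ι i := E.iCycles i
  π i := E.toCycles (i + 1) i
  π_ι i := E.toCycles_i (i + 1) i
  ι_π i := by simp [← cancel_mono (E.iCycles i)]
  shortExact i :=
    have := epi_toCycles hE i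
    .mk' (ShortComplex.exact_of_f_is_kernel _ <| KernelFork.IsLimit.ofι' _ _ fun t ht =>
      ⟨E.liftCycles t i (by simp) (by simpa using ht =≫ E.iCycles i), by simp⟩)
      inferInstance inferInstance

variable {E : ChainComplex A ℤ} (s : Splicing E)

lemma epi_π (i : ℤ) : Epi (s.π i) := (s.shortExact i).epi_g

lemma mono_ι (i : ℤ) : Mono (s.ι i) := by
  obtain ⟨k, rfl⟩ : ∃ k, i = k + 1 := ⟨i - 1, by simp⟩
  exact (s.shortExact k).mono_f

lemma ι_d (i : ℤ) : s.ι (i + 1) ≫ E.d (i + 1) i = 0 := by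
  rw [← s.π_ι, reassoc_of% s.ι_π, zero_comp]

/-- The kernel of the differential of a spliced complex. -/
noncomputable def isLimitKernelFork (i : ℤ) :
    IsLimit (KernelFork.ofι (s.ι (i + 1)) (s.ι_d i)) :=
  have := s.mono_ι
  KernelFork.IsLimit.ofι' _ _ fun t ht =>
    have := (s.shortExact i).mono_f
    ⟨(s.shortExact i).exact.lift t (by
      rw [← cancel_mono (s.ι i), Category.assoc, zero_comp]
      exact (s.π_ι i).symm ▸ ht), (s.shortExact i).exact.lift_f _ _⟩

lemma nonempty_iso_cycles (i : ℤ) : Nonempty (s.Z i ≅ E.cycles i) := by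
  obtain ⟨j, rfl⟩ : ∃ j, i = j + 1 := ⟨i - 1, by simp⟩
  exact ⟨(s.isLimitKernelFork j).conePointUniqueUpToIso
    (E.cyclesIsKernel (j + 1) j (by simp))⟩

lemma acyclic (s : Splicing E) : E.Acyclic := fun i => by
  obtain ⟨j, rfl⟩ : ∃ j, i = j + 1 := ⟨i - 1, by simp⟩
  rw [HomologicalComplex.exactAt_iff' E (j + 1 + 1) (j + 1) j (by simp) (by simp)]
  let φ : E.sc' (j + 1 + 1) (j + 1) j ⟶ .mk _ _ (s.ι_d j) :=
    { τ₁ := s.π (j + 1), τ₂ := 𝟙 _, τ₃ := 𝟙 _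
      comm₁₂ := (s.π_ι _).trans (Category.comp_id _).symm
      comm₂₃ := (Category.id_comp _).trans (Category.comp_id _).symm }
  have : Epi φ.τ₁ := s.epi_π (j + 1)
  have : IsIso φ.τ₂ := inferInstanceAs (IsIso (𝟙 _))
  have : Mono φ.τ₃ := inferInstanceAs (Mono (𝟙 _))
  exact (ShortComplex.exact_iff_of_epi_of_isIso_of_mono φ).2
    (ShortComplex.exact_of_f_is_kernel _ (s.isLimitKernelFork j))

lemma nonempty_iso_image {i j : ℤ} (hij : i = j + 1) : Nonempty (s.Z j ≅ image (E.d i j)) := by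
  subst hij
  have := s.epi_π j
  have := s.mono_ι j
  have := strongEpi_of_epi (s.π j)
  exact ⟨image.isoStrongEpiMono (s.π j) (s.ι j) (s.π_ι j)⟩

lemma isHomExact_iff {𝓗 : ObjectProperty A} :
    IsHomExact 𝓗 E ↔ ∀ i, homExactMono 𝓗 (s.ι i) := by
  have := s.epi_π
  constructor
  · intro h i
    refine ⟨s.mono_ι i, fun H hH t => ?_⟩
    obtain ⟨i, rfl⟩ : ∃ k, i = k + 1 := ⟨i - 1, by simp⟩
    have hi := h H hH (i + 1 + 1)
    rw [add_sub_cancel_right] at hi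
    obtain ⟨k, hk⟩ := (hi (s.π (i + 1) ≫ t)).1 (by
      simp [← s.π_ι, reassoc_of% s.ι_π (i + 1)])
    exact ⟨k, by simp [← cancel_epi (s.π (i + 1)), ← hk, ← s.π_ι]⟩
  · intro h H hH i t
    obtain ⟨i, rfl⟩ : ∃ k, i = k + 1 := ⟨i - 1, by simp⟩
    rw [add_sub_cancel_right]
    constructor
    · intro ht
      have hιt : s.ι (i + 1) ≫ t = 0 := by
        rw [← cancel_epi (s.π (i + 1)), reassoc_of% s.π_ι, comp_zero]
        exact ht
      obtain ⟨l, hl⟩ := (h i).2 H hH ((s.shortExact i).exact.desc t hιt)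
      exact ⟨l, by simpa [← s.π_ι, hl] using (s.shortExact i).exact.g_desc t hιt⟩
    · rintro ⟨k, rfl⟩
      simp

/-- Every sequence of short exact sequences `0 ⟶ Z (i + 1) ⟶ T (i + 1) ⟶ Z i ⟶ 0` splices. -/
noncomputable def ofShortExact {T Z : ℤ → A} {ι : ∀ i, Z i ⟶ T i} {π : ∀ i, T (i + 1) ⟶ Z i}
    {ι_π : ∀ i, ι (i + 1) ≫ π i = 0} (h : ∀ i, (ShortComplex.mk _ _ (ι_π i)).ShortExact) :
    Splicing (ChainComplex.of T (fun i => π i ≫ ι i) fun i => by simp [reassoc_of% ι_π]) where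
  Z := Z
  ι := ι
  π := π
  π_ι i := (ChainComplex.of_d T (fun i => π i ≫ ι i) i).symm
  ι_π := ι_π
  shortExact := h

/-- When colimits are exact, a colimit of acyclic complexes is spliced from the colimits of the
cycles. -/
noncomputable def ofIsColimit {J : Type*} [Category* J] [HasColimitsOfShape J A]
    [HasExactColimitsOfShape J A] {F : J ⥤ ChainComplex A ℤ} (hF : ∀ j, (F.obj j).Acyclic)
    {c : Cocone F} (hc : IsColimit c) : Splicing c.pt :=
  let Z i := F ⋙ HomologicalComplex.cyclesFunctor A _ i
  let T i := F ⋙ HomologicalComplex.eval A _ i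
  let ι i : Z i ⟶ T i :=
    { app j := (F.obj j).iCycles i
      naturality _ _ f := HomologicalComplex.cyclesMap_i (F.map f) i }
  let π i : T (i + 1) ⟶ Z i :=
    { app j := (F.obj j).toCycles (i + 1) i
      naturality _ _ f := (toCycles_cyclesMap (F.map f) (i + 1) i).symm }
  have ι_π i : ι (i + 1) ≫ π i = 0 := by
    ext j
    exact (ofAcyclic (hF j)).ι_π i
  let cZ i : Cocone (Z i) := colimit.cocone (Z i)
  let cT i : Cocone (T i) := (HomologicalComplex.eval A _ i).mapCocone c
  let hZ i : IsColimit (cZ i) := colimit.isColimit (Z i)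
  let hT i : IsColimit (cT i) := isColimitOfPreserves _ hc
  let ι' i : (cZ i).pt ⟶ (cT i).pt := (hZ i).map (cT i) (ι i)
  let π' i : (cT (i + 1)).pt ⟶ (cZ i).pt := (hT (i + 1)).map (cZ i) (π i)
  have hι i j : (cZ i).ι.app j ≫ ι' i = (ι i).app j ≫ (cT i).ι.app j :=
    (hZ i).ι_map (cT i) (ι i) j
  have hπ i j : (cT (i + 1)).ι.app j ≫ π' i = (π i).app j ≫ (cZ i).ι.app j :=
    (hT (i + 1)).ι_map (cZ i) (π i) j
  { Z i := (cZ i).pt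
    ι := ι'
    π := π'
    π_ι i := (hT (i + 1)).hom_ext fun j =>
      have h : (cT (i + 1)).ι.app j ≫ π' i ≫ ι' i
          = (π i).app j ≫ (ι i).app j ≫ (cT i).ι.app j := by rw [reassoc_of% hπ, hι]
      h.trans <| (HomologicalComplex.toCycles_i_assoc ..).trans ((c.ι.app j).comm _ _).symm
    ι_π i := (hZ (i + 1)).hom_ext fun j =>
      calc (cZ (i + 1)).ι.app j ≫ ι' (i + 1) ≫ π' i
          = (ι (i + 1) ≫ π i).app j ≫ (cZ i).ι.app j := by
            rw [reassoc_of% hι, hπ, NatTrans.comp_app, Category.assoc]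
        _ = _ := by rw [ι_π, comp_zero]; exact zero_comp
    shortExact i := shortExact_of_isColimit (S := .mk _ _ (ι_π i))
      (shortExact_of_evaluation fun j => (ofAcyclic (hF j)).shortExact i)
      (hZ (i + 1)) (hT (i + 1)) (hZ i) _ _ (hι (i + 1)) (hπ i) }

lemma projective_X (hs : ∀ i, Projective (s.Z i)) (i : ℤ) : Projective (E.X i) := by
  obtain ⟨j, rfl⟩ : ∃ j, i = j + 1 := ⟨i - 1, by simp⟩
  have := (s.shortExact j).mono_f
  exact .of_iso (s.shortExact j).splittingOfProjective.isoBinaryBiproduct.symm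
    (inferInstanceAs (Projective (s.Z (j + 1) ⊞ s.Z j)))

lemma nonempty_homotopy_id_zero (hs : ∀ i, Projective (s.Z i)) :
    Nonempty (Homotopy (𝟙 E) 0) := by
  have exists_ρ i : ∃ ρ : E.X i ⟶ s.Z i, s.ι i ≫ ρ = 𝟙 _ := by
    obtain ⟨j, rfl⟩ : ∃ j, i = j + 1 := ⟨i - 1, by simp⟩
    have := (s.shortExact j).mono_f
    exact ⟨_, (s.shortExact j).splittingOfProjective.f_r⟩
  choose ρ hρ using exists_ρ
  have := s.epi_π
  let σ i : s.Z i ⟶ E.X (i + 1) := (s.shortExact i).exact.desc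
    (𝟙 _ - ρ (i + 1) ≫ s.ι (i + 1)) (by simp [reassoc_of% hρ])
  have hσ i : s.π i ≫ σ i = 𝟙 _ - ρ (i + 1) ≫ s.ι (i + 1) := (s.shortExact i).exact.g_desc _ _
  have hσ' i : σ i ≫ s.π i = 𝟙 _ := by
    simp [← cancel_epi (s.π i), reassoc_of% hσ, s.ι_π]
  let t : ∀ i j, (ComplexShape.down ℤ).Rel j i → (E.X i ⟶ E.X j) :=
    fun i j (h : i + 1 = j) => ρ i ≫ σ i ≫ eqToHom (by rw [← h])
  refine ⟨(Homotopy.ofEq ?_).trans (Homotopy.nullHomotopy' t)⟩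
  ext i
  obtain ⟨j, rfl⟩ : ∃ j, i = j + 1 := ⟨i - 1, by simp⟩
  rw [Homotopy.nullHomotopicMap'_f
    (show (ComplexShape.down ℤ).Rel (j + 1 + 1) (j + 1) from rfl)
    (show (ComplexShape.down ℤ).Rel (j + 1) j from rfl) t]
  simp [t, ← s.π_ι, reassoc_of% hρ, reassoc_of% hσ', hσ]

lemma projective (hs : ∀ i, Projective (s.Z i)) : Projective E :=
  have := s.projective_X hs
  projective_of_homotopy (s.nonempty_homotopy_id_zero hs).some

end Splicing

variable (𝓟 𝓠 𝓗 : ObjectProperty A)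

/-- The objects `X ≅ Im (P₀ ⟶ Q₋₁)` for an exact and `Hom(-, 𝓗)`-exact sequence
`⋯ ⟶ P₁ ⟶ P₀ ⟶ Q₋₁ ⟶ Q₋₂ ⟶ ⋯` with all `Pᵢ` in `𝓟` and all `Qᵢ` in `𝓠`. -/
def HasCompleteResolution : ObjectProperty A :=
  fun X => ∃ E : ChainComplex A ℤ,
    E.Acyclic ∧ IsHomExact 𝓗 E ∧ (∀ i, 0 ≤ i → 𝓟 (E.X i)) ∧ (∀ i, i < 0 → 𝓠 (E.X i)) ∧
    Nonempty (X ≅ image (E.d 0 (-1)))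

namespace HasCompleteResolution

variable {𝓟 𝓠 𝓗}

lemma isResolved {X : A} (h : HasCompleteResolution 𝓟 𝓠 𝓗 X) :
    IsResolved (homExactEpi 𝓗) 𝓟 X := by
  obtain ⟨E, hE, hE', hP, -, ⟨e⟩⟩ := h
  let s := Splicing.ofAcyclic hE
  let 𝓖 : ObjectProperty A := fun Y => ∃ i, -1 ≤ i ∧ Y = s.Z i
  refine IsResolved.of_coinduction (𝓖 := 𝓖) ?_ X
    ⟨_, ⟨-1, le_rfl, rfl⟩, ⟨e ≪≫ (s.nonempty_iso_image (by simp)).some.symm⟩⟩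
  rintro _ ⟨i, hi, rfl⟩
  have := (s.shortExact i).mono_f
  exact ⟨_, s.π i, hP _ (by lia),
    (homExactEpi_g_iff (s.shortExact i)).2 (s.isHomExact_iff.1 hE' (i + 1)), _,
    ⟨i + 1, by lia, rfl⟩,
    ⟨(kernelIsKernel _).conePointUniqueUpToIso (s.shortExact i).fIsKernel⟩⟩

lemma isCoresolved {X : A} (h : HasCompleteResolution 𝓟 𝓠 𝓗 X) :
    IsCoresolved (homExactMono 𝓗) 𝓠 X := by
  obtain ⟨E, hE, hE', -, hQ, ⟨e⟩⟩ := h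
  let s := Splicing.ofAcyclic hE
  let 𝓖 : ObjectProperty A := fun Y => ∃ i < 0, Y = s.Z i
  refine IsCoresolved.of_coinduction (𝓖 := 𝓖) ?_ X
    ⟨_, ⟨-1, by simp, rfl⟩, ⟨e ≪≫ (s.nonempty_iso_image (by simp)).some.symm⟩⟩
  rintro _ ⟨i, hi, rfl⟩
  obtain ⟨j, rfl⟩ : ∃ j, i = j + 1 := ⟨i - 1, by simp⟩
  have := (s.shortExact j).epi_g
  exact ⟨_, s.ι (j + 1), hQ _ hi, s.isHomExact_iff.1 hE' (j + 1), _, ⟨j, by lia, rfl⟩,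
    ⟨(cokernelIsCokernel _).coconePointUniqueUpToIso (s.shortExact j).gIsCokernel⟩⟩

lemma of_isResolved_of_isCoresolved {X : A} (hX : IsResolved (homExactEpi 𝓗) 𝓟 X)
    (hX' : IsCoresolved (homExactMono 𝓗) 𝓠 X) : HasCompleteResolution 𝓟 𝓠 𝓗 X := by
  choose P p hP hp hK using
    fun Y : Subtype (IsResolved (homExactEpi 𝓗) 𝓟) => Y.2.exists_kernel
  choose Q q hQ hq hC using
    fun Y : Subtype (IsCoresolved (homExactMono 𝓗) 𝓠) => Y.2.exists_cokernel
  let k : ℕ → Subtype (IsResolved (homExactEpi 𝓗) 𝓟) :=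
    fun n => n.rec ⟨X, hX⟩ fun _ Y => ⟨_, hK Y⟩
  let c : ℕ → Subtype (IsCoresolved (homExactMono 𝓗) 𝓠) :=
    fun n => n.rec ⟨X, hX'⟩ fun _ Y => ⟨_, hC Y⟩
  let T : ℤ → A
    | .ofNat n => P (k n)
    | .negSucc n => Q (c n)
  let Z : ℤ → A
    | .ofNat n => (k (n + 1)).1
    | .negSucc n => (c n).1
  let ι : ∀ i, Z i ⟶ T i
    | .ofNat n => kernel.ι (p (k n))
    | .negSucc n => q (c n)
  let π : ∀ i, T (i + 1) ⟶ Z i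
    | .ofNat n => p (k (n + 1))
    | .negSucc 0 => p (k 0)
    | .negSucc (n + 1) => cokernel.π (q (c n))
  have ι_π : ∀ i, ι (i + 1) ≫ π i = 0
    | .ofNat n => kernel.condition (p (k (n + 1)))
    | .negSucc 0 => kernel.condition (p (k 0))
    | .negSucc (n + 1) => cokernel.condition (q (c n))
  have hS : ∀ i, (ShortComplex.mk _ _ (ι_π i)).ShortExact
    | .ofNat n => have := (hp (k (n + 1))).1; shortExact_kernel _
    | .negSucc 0 => have := (hp (k 0)).1; shortExact_kernel _
    | .negSucc (n + 1) => have := (hq (c n)).1; shortExact_cokernel (q (c n))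
  let s := Splicing.ofShortExact hS
  have hι : ∀ i, homExactMono 𝓗 (s.ι i) := Int.rec (fun n => (hp (k n)).2) fun n => hq (c n)
  have e : Nonempty (s.Z (-1) ≅ _) := s.nonempty_iso_image (i := 0) rfl
  exact ⟨_, s.acyclic, s.isHomExact_iff.2 hι,
    Int.rec (fun n _ => hP (k n)) fun n hn => absurd hn (Int.negSucc_lt_zero n).not_ge,
    Int.rec (fun n hn => absurd hn (Int.natCast_nonneg n).not_gt) fun n _ => hQ (c n), e⟩

lemma of_biprod (h𝓟 : 𝓟 ≤ isProjective A) (h𝓠 : 𝓠 ≤ 𝓗) [𝓠.IsClosedUnderIsomorphisms]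
    [𝓟.IsClosedUnderBinaryCoproducts] [𝓠.IsClosedUnderBinaryCoproducts]
    {X A₁ A₂ : A} (h : HasCompleteResolution 𝓟 𝓠 𝓗 X) (e : X ≅ A₁ ⊞ A₂) :
    HasCompleteResolution 𝓟 𝓠 𝓗 A₁ :=
  .of_isResolved_of_isCoresolved
    (.of_biprod homExactEpi_biprod_fst (h𝓟.trans projective_le_relProjective)
      (fun _ _ => 𝓟.prop_of_isColimit_binaryCofan (BinaryBiproduct.isColimit _ _))
      (ObjectProperty.prop_of_iso _ e h.isResolved))
    (.of_biprod homExactMono_biprod_inl (fun Q hQ => op_le_relProjective Q (h𝓠 Q.unop hQ))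
      (fun _ _ => 𝓠.prop_of_isColimit_binaryCofan (BinaryBiproduct.isColimit _ _))
      (ObjectProperty.prop_of_iso _ e h.isCoresolved))

lemma sigma {J : Type*} [HasColimitsOfShape (Discrete J) A]
    [HasExactColimitsOfShape (Discrete J) A] [𝓟.IsClosedUnderColimitsOfShape (Discrete J)]
    [𝓠.IsClosedUnderColimitsOfShape (Discrete J)] {X : J → A}
    (h : ∀ j, HasCompleteResolution 𝓟 𝓠 𝓗 (X j)) : HasCompleteResolution 𝓟 𝓠 𝓗 (∐ X) :=
  .of_isResolved_of_isCoresolved (.sigma fun j => (h j).isResolved)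
    (.sigma fun j => (h j).isCoresolved)

end HasCompleteResolution

end Splicing

section ObjectProperty

lemma isClosedUnderColimitsOfShape_isProjective {A : Type*} [Category* A] {J : Type*} :
    (isProjective A).IsClosedUnderColimitsOfShape (Discrete J) where
  colimitsOfShape_le _ := fun ⟨h⟩ =>
    { factors f e _ :=
        have := h.prop_diag_obj
        let l j := Projective.factorThru (h.ι.app j ≫ f) e
        ⟨h.isColimit.desc (.mk _ (Discrete.natTrans l)), h.isColimit.hom_ext fun j => by
          rw [h.isColimit.fac_assoc]
          exact Projective.factorThru_comp _ _⟩ }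

lemma isClosedUnderColimitsOfShape_map {A B : Type*} [Category* A] [Category* B] {J : Type*}
    [HasColimitsOfShape (Discrete J) A] (𝓟 : ObjectProperty A)
    [𝓟.IsClosedUnderColimitsOfShape (Discrete J)] (F : A ⥤ B)
    [PreservesColimitsOfShape (Discrete J) F] :
    (𝓟.map F).IsClosedUnderColimitsOfShape (Discrete J) where
  colimitsOfShape_le _ := fun ⟨h⟩ => by
    choose Y hY e using fun j => h.prop_diag_obj j
    let D : Discrete J ⥤ A := Discrete.functor fun j => Y ⟨j⟩
    exact ⟨_, 𝓟.prop_colimit D fun j => hY j,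
      ⟨(isColimitOfPreserves F (colimit.isColimit D)).coconePointsIsoOfNatIso h.isColimit
        (Discrete.natIso fun j => (e j).some)⟩⟩

end ObjectProperty

section Modules

variable {R : Type u} [CommRing R] {𝒳 : ObjectProperty (ModuleCat.{u} R)}

lemma tilde_of_splicing [𝒳.IsClosedUnderIsomorphisms] {E : Ch R} (s : Splicing E)
    (hs : ∀ i, 𝒳 (s.Z i)) : tilde 𝒳 E :=
  ⟨s.acyclic, fun i => 𝒳.prop_of_iso (s.nonempty_iso_cycles i).some (hs i)⟩

instance [𝒳.IsClosedUnderIsomorphisms] : (tilde 𝒳).IsClosedUnderIsomorphisms where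
  of_iso e h := ⟨fun i => (h.1 i).of_iso e, fun i => 𝒳.prop_of_iso
    ((HomologicalComplex.cyclesFunctor _ _ i).mapIso e) (h.2 i)⟩

instance {J : Type*} [Category* J] [HasColimitsOfShape J (ModuleCat.{u} R)]
    [HasExactColimitsOfShape J (ModuleCat.{u} R)] [𝒳.IsClosedUnderIsomorphisms]
    [𝒳.IsClosedUnderColimitsOfShape J] : (tilde 𝒳).IsClosedUnderColimitsOfShape J where
  colimitsOfShape_le _ := fun ⟨h⟩ =>
    tilde_of_splicing (.ofIsColimit (fun j => (h.prop_diag_obj j).1) h.isColimit)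
      fun i => 𝒳.prop_colimit _ fun j => (h.prop_diag_obj j).2 i

lemma projectiveModules_eq_isProjective :
    projectiveModules R = isProjective (ModuleCat.{u} R) := by
  ext M
  exact IsProjective.iff_projective M

lemma cProjectiveModules_eq_map (C : ModuleCat.{u} R) :
    cProjectiveModules C = (projectiveModules R).map (MonoidalCategory.tensorLeft C) := by
  ext M
  exact exists_congr fun P => and_congr_right fun _ =>
    ⟨fun ⟨e⟩ => ⟨e.symm.toModuleIso⟩, fun ⟨e⟩ => ⟨e.toLinearEquiv.symm⟩⟩

instance : (projectiveModules R).IsClosedUnderIsomorphisms where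
  of_iso {M _} e (h : Module.Projective R M) := h.of_equiv' e.toLinearEquiv

instance (C : ModuleCat.{u} R) : (cProjectiveModules C).IsClosedUnderIsomorphisms :=
  cProjectiveModules_eq_map C ▸ inferInstance

instance {J : Type*} : (projectiveModules R).IsClosedUnderColimitsOfShape (Discrete J) :=
  projectiveModules_eq_isProjective (R := R) ▸ isClosedUnderColimitsOfShape_isProjective

instance (C : ModuleCat.{u} R) {J : Type*} [HasColimitsOfShape (Discrete J) (ModuleCat.{u} R)] :
    (cProjectiveModules C).IsClosedUnderColimitsOfShape (Discrete J) :=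
  cProjectiveModules_eq_map C ▸ isClosedUnderColimitsOfShape_map _ _

lemma cProjectiveModules_le_cFlatModules (C : ModuleCat.{u} R) :
    cProjectiveModules C ≤ cFlatModules C :=
  fun _ ⟨P, _, e⟩ => ⟨P, .of_projective, e⟩

lemma tilde_monotone {𝒴 : ObjectProperty (ModuleCat.{u} R)} (h : 𝒳 ≤ 𝒴) : tilde 𝒳 ≤ tilde 𝒴 :=
  fun _ hE => ⟨hE.1, fun i => h _ (hE.2 i)⟩

lemma tilde_projectiveModules_le : tilde (projectiveModules R) ≤ isProjective (Ch R) :=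
  fun _ hE => (Splicing.ofAcyclic hE.1).projective fun i =>
    projectiveModules_eq_isProjective.le _ (hE.2 i)

lemma isDCProjective_eq (C : ModuleCat.{u} R) : IsDCProjective C = HasCompleteResolution
    (tilde (projectiveModules R)) (tilde (cProjectiveModules C)) (tilde (cFlatModules C)) :=
  rfl

end Modules

end DingComplex

theorem corollary2p11_general {R : Type u} [CommRing R] (C : ModuleCat.{u} R) :
    (∀ X A B : DingComplex.Ch R, DingComplex.IsDCProjective C X → Nonempty (X ≅ A ⊞ B) →
      DingComplex.IsDCProjective C A) ∧
    (∀ (Λ : Type u) (X : Λ → DingComplex.Ch R),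
      (∀ l, DingComplex.IsDCProjective C (X l)) → DingComplex.IsDCProjective C (∐ X)) := by
  rw [DingComplex.isDCProjective_eq]
  exact ⟨fun _ _ _ h ⟨e⟩ => h.of_biprod DingComplex.tilde_projectiveModules_le
      (DingComplex.tilde_monotone (DingComplex.cProjectiveModules_le_cFlatModules C)) e,
    fun _ _ => .sigma⟩

theorem corollary2p11 {R : Type u} [CommRing R] (C : ModuleCat.{u} R)
    (hC : DingComplex.IsSemidualizing C) :
    (∀ X A B : DingComplex.Ch R, DingComplex.IsDCProjective C X → Nonempty (X ≅ A ⊞ B) →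
      DingComplex.IsDCProjective C A) ∧
    (∀ (Λ : Type u) (X : Λ → DingComplex.Ch R),
      (∀ l, DingComplex.IsDCProjective C (X l)) → DingComplex.IsDCProjective C (∐ X)) :=
  corollary2p11_general C
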